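/- **Theorem (FRPP).** Let $\mathbf{X}\in\mathbb{R}^{n\times p}$ be a fixed design whose columns have Euclidean norm $1$ and for which $\Sigma=\mathbf{X}^\top\mathbf{X}$ is invertible, and let $\mathbf{y}=\mathbf{X}\boldsymbol\beta+\mathbf{w}$ with $\boldsymbol\beta\in\mathbb{R}^p$ fixed and $\mathbf{w}\sim\mathcal{N}(0,\sigma^2\mathbf{I}_n)$. Let $\widetilde{\mathbf{X}}\in\mathbb{R}^{n\times p}$ be a knockoff matrix, i.e. $\widetilde{\mathbf{X}}^\top\widetilde{\mathbf{X}}=\Sigma$ and $\mathbf{X}^\top\widetilde{\mathbf{X}}=\Sigma-\mathrm{diag}(\mathbf{s})$, where $\mathbf{s}_i=1-\mathbf{X}_i^\top\widetilde{\mathbf{X}}_i$, and put $\mathbf{G}=[\mathbf{X}\ \widetilde{\mathbf{X}}]^\top[\mathbf{X}\ \widetilde{\mathbf{X}}]$. Fix $\epsilon>0$, $\delta\ge 0$ and $q\in[0,1]$, and let $\mathcal{S}_0=\{i:|\beta_i|\le\delta\}$. Let $\Delta$ be a random vector in $\mathbb{R}^{2p}$, independent of $\mathbf{w}$, with mutually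 independent coordinates such that $\Delta_i$ and $\Delta_{i+p}$ both have the centred Laplace distribution with scale $2\mathbf{s}_i\delta/\epsilon$, $1\le i\le p$ (the point mass at $0$ if the scale is $0$). Let $\tilde{\boldsymbol\theta}=\mathcal{T}(\mathbf{G},[\mathbf{X}\ \widetilde{\mathbf{X}}]^\top\mathbf{y}+\Delta)\in\mathbb{R}^{2p}$, where $\mathcal{T}$ is a deterministic operator, measurable in its second argument, with $P_i\,\mathcal{T}(\mathbf{G},\mathbf{z})=\mathcal{T}(\mathbf{G},P_i\mathbf{z})$ for all $\mathbf{z}\in\mathbb{R}^{2p}$ and $1\le i\le p$; here $P_i$ swaps the $i$-th and $(i+p)$-th coordinates. Let $W=\mathcal{W}(\tilde{\boldsymbol\theta})\in\mathbb{R}^p$, where $\mathcal{W}:\mathbb{R}^{2p}\to\mathbb{R}^p$ is measurable and antisymmetric: for every $F\subseteq\{1,\dots,p\}$, swapping the $i$-th and $(i+p)$-th coordinates of the argument for all $i\in F$ switches the signs of $W_i$, $i\in F$, and leaves the other $W_i$ unchanged. Run the knockoff procedure at target level $q'=q/e^{\epsilon}$, i.e. select $\hat{\mathcal{S}}=\{j:W_j\ge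 T\}$ with $$T=\inf\Big\{t\in\{|W_1|,\dots,|W_p|\}\setminus\{0\}:\ \frac{1+\#\{j:W_j\le -t\}}{\max(\#\{j:W_j\ge t\},1)}\le q'\Big\},\qquad \inf\emptyset=+\infty .$$ Then $$\mathrm{FDR}=\mathbb{E}\left[\frac{|\hat{\mathcal{S}}\cap\mathcal{S}_0|}{\max(|\hat{\mathcal{S}}|,1)}\right]\le q .$$ -/

import Mathlib

open MeasureTheory ProbabilityTheory
open scoped Matrix NNReal

namespace Knockoff

noncomputable section

/-- The centred Laplace distribution `Lap(b)` with scale `b`, of density `exp (-|x| / b) / (2 b)`.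
The degenerate scale `b = 0` gives the point mass at `0` (negative scales never occur). -/
def laplace (b : ℝ) : Measure ℝ :=
  if 0 < b then
    volume.withDensity (fun x => ENNReal.ofReal (Real.exp (-|x| / b) / (2 * b)))
  else Measure.dirac 0

/-- The vector `s` with entries `s i = 1 - ⟨X_i, X̃_i⟩`, where `X_i`, `X̃_i` are the `i`-th columns. -/
def gap {n p : ℕ} (X Xk : Matrix (Fin n) (Fin p) ℝ) (i : Fin p) : ℝ :=
  1 - (X.col i) ⬝ᵥ (Xk.col i)

/-- `Xk` is a knockoff matrix for the design `X` (with normalized columns):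
`X̃ᵀ X̃ = Σ` and `Xᵀ X̃ = Σ - diag s`, where `Σ = Xᵀ X`. -/
structure IsKnockoff {n p : ℕ} (X Xk : Matrix (Fin n) (Fin p) ℝ) : Prop where
  gram_eq : Xkᵀ * Xk = Xᵀ * X
  cross_eq : Xᵀ * Xk = Xᵀ * X - Matrix.diagonal (gap X Xk)

/-- The Gram matrix `G = [X X̃]ᵀ [X X̃]` of the augmented design. -/
def gram {n p : ℕ} (X Xk : Matrix (Fin n) (Fin p) ℝ) :
    Matrix (Fin p ⊕ Fin p) (Fin p ⊕ Fin p) ℝ :=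
  (Matrix.fromCols X Xk)ᵀ * Matrix.fromCols X Xk

/-- Swap the entries `i` and `i + p` of a vector of length `2p`, for every `i ∈ F`. -/
def swap {p : ℕ} (F : Finset (Fin p)) (v : Fin p ⊕ Fin p → ℝ) : Fin p ⊕ Fin p → ℝ :=
  Sum.elim
    (fun i => if i ∈ F then v (Sum.inr i) else v (Sum.inl i))
    (fun i => if i ∈ F then v (Sum.inl i) else v (Sum.inr i))

/-- The estimator `T(G, ·)` is swap-equivariant: `P_i T(G, z) = T(G, P_i z)` for all `i` and `z`. -/
def SwapEquivariant {p : ℕ} (TG : (Fin p ⊕ Fin p → ℝ) → (Fin p ⊕ Fin p → ℝ)) : Prop :=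
  ∀ (i : Fin p) (z : Fin p ⊕ Fin p → ℝ), TG (swap {i} z) = swap {i} (TG z)

/-- `𝒲` computes antisymmetric statistics from the estimates: swapping the estimates of `i` and of
its knockoff for all `i ∈ F` switches the signs of exactly the statistics with index in `F`. -/
def Antisymmetric {p : ℕ} (𝒲 : (Fin p ⊕ Fin p → ℝ) → (Fin p → ℝ)) : Prop :=
  ∀ (F : Finset (Fin p)) (θ : Fin p ⊕ Fin p → ℝ) (j : Fin p),
    𝒲 (swap F θ) j = if j ∈ F then -𝒲 θ j else 𝒲 θ j

/-- The estimate `(1 + #{j : W_j ≤ -t}) / (#{j : W_j ≥ t} ∨ 1)` of the false discovery proportion. -/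
def fdpHat {p : ℕ} (W : Fin p → ℝ) (t : ℝ) : ℝ :=
  (1 + ((Finset.univ.filter fun j => W j ≤ -t).card : ℝ)) /
    max ((Finset.univ.filter fun j => t ≤ W j).card : ℝ) 1

/-- The knockoff threshold `inf {t ∈ Ψ : fdpHat t ≤ q}` with `Ψ = {|W_i|} \ {0}`; it is `+∞` if no
such `t` exists. -/
def threshold {p : ℕ} (q : ℝ) (W : Fin p → ℝ) : EReal :=
  sInf ((fun t : ℝ => (t : EReal)) ''
    {t : ℝ | t ∈ Set.range (fun i => |W i|) \ {0} ∧ fdpHat W t ≤ q})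

/-- The set of variables selected by the knockoff procedure with target FDR `q`. -/
def selected {p : ℕ} (q : ℝ) (W : Fin p → ℝ) : Finset (Fin p) :=
  Finset.univ.filter fun j => threshold q W ≤ (W j : EReal)

/-- The composite nulls `{i : |β_i| ≤ δ}`. -/
def nulls {p : ℕ} (β : Fin p → ℝ) (δ : ℝ) : Finset (Fin p) :=
  Finset.univ.filter fun i => |β i| ≤ δ

/-- The false discovery proportion `|S ∩ S₀| / max (|S|, 1)`. -/
def fdp {p : ℕ} (S S₀ : Finset (Fin p)) : ℝ :=
  ((S ∩ S₀).card : ℝ) / max (S.card : ℝ) 1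

/-- The statistics `𝒲 (T (G, [X X̃]ᵀ y + Δ))` computed from the perturbed products. -/
def frppStatistics {n p : ℕ} (X Xk : Matrix (Fin n) (Fin p) ℝ)
    (T : Matrix (Fin p ⊕ Fin p) (Fin p ⊕ Fin p) ℝ →
      (Fin p ⊕ Fin p → ℝ) → (Fin p ⊕ Fin p → ℝ))
    (𝒲 : (Fin p ⊕ Fin p → ℝ) → (Fin p → ℝ))
    (y : Fin n → ℝ) (Δ : Fin p ⊕ Fin p → ℝ) : Fin p → ℝ :=
  𝒲 (T (gram X Xk) ((Matrix.fromCols X Xk)ᵀ *ᵥ y + Δ))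

end

end Knockoff

/-! Let μ be the law of the perturbed products, with A the transposed augmented design: mean A X β,
plus A w, plus Laplace noise. Swapping the entries of variable j and its knockoff preserves the law
of A w, whose covariance is σ² times the swap-invariant Gram matrix, and the law of the noise. It
moves only two entries of the mean, each by |s_j β_j| ≤ s_j δ when j is null. At scale 2 s_j δ / ε
each such shift costs a factor e^(ε/2), so μ is at most e^ε times its image under the swap
(`IsKnockoff.map_perturbed_le`). By equivariance and antisymmetry, that swap flips the sign of W_j
alone.

Approximate sign symmetry, one null at a time, suffices for a leave-one-out argument. With q' the
target level, FDP ≤ q' Σ_j `weight` j over the nulls (`fdp_selected_le_sum_weight`). Flipping W_j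
inside the j-th term costs e^ε in expectation, and the flipped weights sum to at most 1 pointwise
(`sum_weight_update_neg_le_one`). Hence FDR ≤ q' e^ε = q. -/

namespace Knockoff

/-! ### The threshold -/

lemma threshold_eq_top_or {p : ℕ} (q : ℝ) (W : Fin p → ℝ) :
    threshold q W = ⊤ ∨
      ∃ i, |W i| ≠ 0 ∧ fdpHat W |W i| ≤ q ∧ threshold q W = ((|W i| : ℝ) : EReal) := by
  set Ψ : Set ℝ := {t : ℝ | t ∈ Set.range (fun i => |W i|) \ {0} ∧ fdpHat W t ≤ q} with hΨ
  have hfin : Ψ.Finite := (Set.finite_range fun i => |W i|).subset fun t ht => ht.1.1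
  rcases Ψ.eq_empty_or_nonempty with h | h
  · left
    rw [threshold, ← hΨ, h]
    simp
  · right
    have hmem := (h.image (fun t : ℝ => (t : EReal))).csInf_mem (hfin.image _)
    obtain ⟨t, ⟨⟨⟨i, rfl⟩, h0⟩, hq⟩, ht⟩ := hmem
    exact ⟨i, h0, hq, ht.symm⟩

lemma threshold_le {p : ℕ} {q : ℝ} {W : Fin p → ℝ} {i : Fin p} (h0 : |W i| ≠ 0)
    (hq : fdpHat W |W i| ≤ q) : threshold q W ≤ ((|W i| : ℝ) : EReal) :=
  sInf_le ⟨|W i|, ⟨⟨⟨i, rfl⟩, h0⟩, hq⟩, rfl⟩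

/-- The index set no longer depends on `W`, so measurability can be checked term by term. -/
lemma threshold_eq_iInf {p : ℕ} (q : ℝ) (W : Fin p → ℝ) :
    threshold q W =
      ⨅ i, if |W i| ≠ 0 ∧ fdpHat W |W i| ≤ q then ((|W i| : ℝ) : EReal) else ⊤ := by
  apply le_antisymm
  · refine le_iInf fun i => ?_
    split_ifs with h
    · exact threshold_le h.1 h.2
    · exact le_top
  · rcases threshold_eq_top_or q W with h | ⟨i, h0, hq, h⟩ <;> rw [h]
    · exact le_top
    · exact (iInf_le _ i).trans_eq (if_pos ⟨h0, hq⟩)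

lemma measurable_card_filter {α ι : Type*} [MeasurableSpace α] [Fintype ι] (s : α → ι → Prop)
    [∀ a, DecidablePred (s a)] (hs : ∀ i, MeasurableSet {a | s a i}) :
    Measurable fun a => ((Finset.univ.filter (s a)).card : ℝ) := by
  simp_rw [Finset.card_filter, Nat.cast_sum]
  refine Finset.measurable_sum _ fun i _ => ?_
  simp only [Nat.cast_ite, Nat.cast_one, Nat.cast_zero]
  exact Measurable.ite (hs i) measurable_const measurable_const

lemma measurable_fdpHat {p : ℕ} {α : Type*} [MeasurableSpace α] {W : α → Fin p → ℝ} {t : α → ℝ}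
    (hW : Measurable W) (ht : Measurable t) : Measurable fun a => fdpHat (W a) (t a) := by
  have hWi : ∀ i, Measurable fun a => W a i := fun i => (measurable_pi_apply i).comp hW
  unfold fdpHat
  refine Measurable.div (measurable_const.add ?_) (Measurable.max ?_ measurable_const)
  · exact measurable_card_filter _ fun i => measurableSet_le (hWi i) ht.neg
  · exact measurable_card_filter _ fun i => measurableSet_le ht (hWi i)

@[fun_prop]
lemma measurable_threshold {p : ℕ} (q : ℝ) :
    Measurable (threshold q : (Fin p → ℝ) → EReal) := by
  have : (threshold q : (Fin p → ℝ) → EReal) = fun W => ⨅ i,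
      if |W i| ≠ 0 ∧ fdpHat W |W i| ≤ q then ((|W i| : ℝ) : EReal) else ⊤ :=
    funext fun W => threshold_eq_iInf q W
  rw [this]
  refine Measurable.iInf fun i => ?_
  have habs : Measurable fun W : Fin p → ℝ => |W i| := (measurable_pi_apply i).abs
  refine Measurable.ite (MeasurableSet.inter ?_ ?_) habs.coe_real_ereal measurable_const
  · exact (measurableSet_eq_fun habs measurable_const).compl
  · exact measurableSet_le (measurable_fdpHat measurable_id habs) measurable_const

lemma measurable_fdp_selected {p : ℕ} (q : ℝ) (S₀ : Finset (Fin p)) :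
    Measurable fun W : Fin p → ℝ => fdp (selected q W) S₀ := by
  have hset : ∀ i, MeasurableSet {W : Fin p → ℝ | threshold q W ≤ ((W i : ℝ) : EReal)} :=
    fun i => measurableSet_le (measurable_threshold q) (measurable_pi_apply i).coe_real_ereal
  unfold fdp selected
  refine Measurable.div ?_ (Measurable.max (measurable_card_filter _ hset) measurable_const)
  simp_rw [Finset.filter_inter, Finset.univ_inter, Finset.card_filter, Nat.cast_sum]
  refine Finset.measurable_sum _ fun i _ => ?_
  simp only [Nat.cast_ite, Nat.cast_one, Nat.cast_zero]
  exact Measurable.ite (hset i) measurable_const measurable_const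

lemma fdp_nonneg {p : ℕ} (S S₀ : Finset (Fin p)) : 0 ≤ fdp S S₀ := by
  unfold fdp; positivity

lemma fdp_le_one {p : ℕ} (S S₀ : Finset (Fin p)) : fdp S S₀ ≤ 1 := by
  unfold fdp
  refine div_le_one_of_le₀ (le_max_of_le_left ?_) (by positivity)
  exact_mod_cast Finset.card_le_card Finset.inter_subset_left

/-! ### The leave-one-out weights -/

/-- The threshold computed after the sign of the `j`-th statistic has been made positive. -/
noncomputable def looThreshold {p : ℕ} (q : ℝ) (j : Fin p) (W : Fin p → ℝ) : EReal :=
  threshold q (Function.update W j |W j|)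

/-- The `j`-th contribution to the bound on the false discovery proportion. -/
noncomputable def weight {p : ℕ} (q : ℝ) (j : Fin p) (W : Fin p → ℝ) : ℝ :=
  if looThreshold q j W ≤ (W j : EReal) then
    (1 + ((Finset.univ.filter fun k =>
      k ≠ j ∧ looThreshold q j W ≤ ((-W k : ℝ) : EReal)).card : ℝ))⁻¹
  else 0

lemma weight_nonneg {p : ℕ} (q : ℝ) (j : Fin p) (W : Fin p → ℝ) : 0 ≤ weight q j W := by
  unfold weight; split_ifs <;> positivity

lemma weight_le_one {p : ℕ} (q : ℝ) (j : Fin p) (W : Fin p → ℝ) : weight q j W ≤ 1 := by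
  unfold weight
  split_ifs
  · exact inv_le_one_of_one_le₀ (by simp)
  · exact zero_le_one

lemma measurable_weight {p : ℕ} (q : ℝ) (j : Fin p) :
    Measurable (weight q j : (Fin p → ℝ) → ℝ) := by
  have hupd : Measurable fun W : Fin p → ℝ => Function.update W j |W j| := by
    refine measurable_pi_iff.2 fun k => ?_
    by_cases hk : k = j
    · subst hk
      simpa using (measurable_pi_apply k).abs
    · simpa [Function.update_of_ne hk] using measurable_pi_apply k
  have hT : Measurable (looThreshold q j : (Fin p → ℝ) → EReal) :=
    (measurable_threshold q).comp hupd
  refine Measurable.ite (measurableSet_le hT (measurable_pi_apply j).coe_real_ereal)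
    (measurable_const.add (measurable_card_filter _ fun k => ?_)).inv measurable_const
  exact (MeasurableSet.const _).inter
    (measurableSet_le hT (measurable_pi_apply k).neg.coe_real_ereal)

lemma fdp_selected_le_sum_weight {p : ℕ} {q : ℝ} (hq : 0 ≤ q) (W : Fin p → ℝ)
    (S₀ : Finset (Fin p)) :
    fdp (selected q W) S₀ ≤ q * ∑ j ∈ S₀, weight q j W := by
  have hnn : 0 ≤ q * ∑ j ∈ S₀, weight q j W :=
    mul_nonneg hq (Finset.sum_nonneg fun j _ => weight_nonneg q j W)
  rcases threshold_eq_top_or q W with h | ⟨i, h0, hfd, h⟩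
  · have : selected q W = ∅ := by
      simp [selected, h]
    simpa [fdp, this] using hnn
  set t := |W i|
  have htpos : 0 < t := lt_of_le_of_ne (abs_nonneg (W i)) h0.symm
  have hsel : selected q W = Finset.univ.filter fun j => t ≤ W j := by
    simp [selected, h]
  set N : ℝ := ((Finset.univ.filter fun j => W j ≤ -t).card : ℝ)
  -- A selected j has W_j > 0: its leave-one-out threshold is the actual one, and excluding j from
  -- the negative count removes nothing.
  have hweight : ∀ j ∈ selected q W ∩ S₀, (1 + N)⁻¹ = weight q j W := by
    intro j hj
    have hj' : t ≤ W j := by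
      have := (Finset.mem_inter.1 hj).1
      simpa [hsel] using this
    have hloo : looThreshold q j W = (t : EReal) := by
      rw [looThreshold, abs_of_pos (htpos.trans_le hj'), Function.update_eq_self, h]
    rw [weight, hloo, if_pos (by exact_mod_cast hj')]
    suffices h' : (Finset.univ.filter fun k => W k ≤ -t) =
        Finset.univ.filter fun k => k ≠ j ∧ (t : EReal) ≤ ((-W k : ℝ) : EReal) by
      simp only [N, h']
    refine Finset.filter_congr fun k _ => ?_
    rw [EReal.coe_le_coe_iff]
    constructor
    · intro hk
      exact ⟨by rintro rfl; linarith, by linarith⟩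
    · rintro ⟨-, hk⟩
      linarith
  have hsum : ((selected q W ∩ S₀).card : ℝ) * (1 + N)⁻¹ ≤ ∑ j ∈ S₀, weight q j W := by
    rw [← nsmul_eq_mul, ← Finset.sum_const, Finset.sum_congr rfl hweight]
    exact Finset.sum_le_sum_of_subset_of_nonneg Finset.inter_subset_right
      fun j _ _ => weight_nonneg q j W
  refine le_trans ?_ (mul_le_mul_of_nonneg_left hsum hq)
  have hN : 0 < 1 + N := by positivity
  have hM : (0 : ℝ) < max ((selected q W).card : ℝ) 1 := by positivity
  have hfd' : (1 + N) / max ((selected q W).card : ℝ) 1 ≤ q := by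
    rw [hsel]; exact hfd
  unfold fdp
  calc ((selected q W ∩ S₀).card : ℝ) / max ((selected q W).card : ℝ) 1
      = ((1 + N) / max ((selected q W).card : ℝ) 1) *
          (((selected q W ∩ S₀).card : ℝ) * (1 + N)⁻¹) := by field_simp
    _ ≤ _ := mul_le_mul_of_nonneg_right hfd' (by positivity)

lemma card_filter_le_neg_update {p : ℕ} (W : Fin p → ℝ) (j : Fin p) {t : ℝ} (ht : 0 < t)
    (hj : t ≤ -W j) :
    (Finset.univ.filter fun k => Function.update W j |W j| k ≤ -t) =
      (Finset.univ.filter fun k => W k ≤ -t).erase j := by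
  ext k
  by_cases hk : k = j
  · subst hk
    have := abs_nonneg (W k)
    simp only [Finset.mem_filter, Function.update_self, Finset.mem_erase]
    constructor
    · rintro ⟨-, h⟩; linarith
    · rintro ⟨h, -⟩; exact absurd rfl h
  · simp [hk]

lemma card_filter_le_update {p : ℕ} (W : Fin p → ℝ) (j : Fin p) {t : ℝ}
    (hj : t ≤ -W j) :
    (Finset.univ.filter fun k => t ≤ Function.update W j |W j| k) =
      insert j (Finset.univ.filter fun k => t ≤ W k) := by
  ext k
  by_cases hk : k = j
  · subst hk
    have := neg_le_abs (W k)
    simp only [Finset.mem_filter, Function.update_self, Finset.mem_insert, true_or, iff_true]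
    exact ⟨Finset.mem_univ _, by linarith⟩
  · simp [hk]

/-- Both updates move exactly one index from the negative count to the positive count, and `fdpHat`
sees only the two cardinalities. -/
lemma fdpHat_update_eq {p : ℕ} (W : Fin p → ℝ) {j k : Fin p} {t : ℝ} (ht : 0 < t)
    (hj : t ≤ -W j) (hk : t ≤ -W k) :
    fdpHat (Function.update W j |W j|) t = fdpHat (Function.update W k |W k|) t := by
  unfold fdpHat
  rw [card_filter_le_neg_update W j ht hj, card_filter_le_neg_update W k ht hk,
    card_filter_le_update W j hj, card_filter_le_update W k hk]
  rw [Finset.card_erase_of_mem (by simp; linarith), Finset.card_erase_of_mem (by simp; linarith),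
    Finset.card_insert_of_notMem (by simp; linarith),
    Finset.card_insert_of_notMem (by simp; linarith)]

/-- The threshold for j is some |W_i|, and there both modified vectors have the same `fdpHat`; it is
therefore also feasible for k. -/
lemma looThreshold_le_of_le {p : ℕ} {q : ℝ} {W : Fin p → ℝ} {j k : Fin p}
    (hj : looThreshold q j W ≤ ((-W j : ℝ) : EReal))
    (hk : looThreshold q j W ≤ ((-W k : ℝ) : EReal)) :
    looThreshold q k W ≤ looThreshold q j W := by
  have habs : ∀ l i, |Function.update W l |W l| i| = |W i| := by
    intro l i
    by_cases h : i = l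
    · subst h; simp
    · simp [h]
  rcases threshold_eq_top_or q (Function.update W j |W j|) with h | ⟨i, h0, hfd, h⟩
  · rw [looThreshold, h] at hj
    exact absurd (top_le_iff.1 hj) (EReal.coe_ne_top _)
  · rw [habs] at h0 hfd h
    rw [looThreshold, h, EReal.coe_le_coe_iff] at hj hk
    rw [looThreshold, looThreshold, h, ← habs k i]
    have hpos : 0 < |W i| := lt_of_le_of_ne (abs_nonneg (W i)) h0.symm
    refine threshold_le (by rwa [habs]) ?_
    rw [habs, ← fdpHat_update_eq W hpos hj hk]
    exact hfd

lemma looThreshold_update_neg {p : ℕ} (q : ℝ) (j : Fin p) (W : Fin p → ℝ) :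
    looThreshold q j (Function.update W j (-W j)) = looThreshold q j W := by
  simp [looThreshold]

lemma sum_weight_update_neg_le_one {p : ℕ} (q : ℝ) (W : Fin p → ℝ) (S₀ : Finset (Fin p)) :
    ∑ j ∈ S₀, weight q j (Function.update W j (-W j)) ≤ 1 := by
  -- A collects the j whose weight survives the flip. Each surviving denominator is at least the
  -- cardinality of A, so the sum is at most 1.
  set A : Finset (Fin p) :=
    Finset.univ.filter fun j => looThreshold q j W ≤ ((-W j : ℝ) : EReal)
  have hbound : ∀ j, weight q j (Function.update W j (-W j)) ≤
      if j ∈ A then (A.card : ℝ)⁻¹ else 0 := by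
    intro j
    unfold weight
    rw [looThreshold_update_neg, Function.update_self]
    by_cases hj : looThreshold q j W ≤ ((-W j : ℝ) : EReal)
    · have hjA : j ∈ A := Finset.mem_filter.2 ⟨Finset.mem_univ _, hj⟩
      rw [if_pos hj, if_pos hjA]
      have hcard : (0 : ℝ) < A.card := by exact_mod_cast Finset.card_pos.2 ⟨j, hjA⟩
      refine inv_anti₀ hcard ?_
      have hsub : A.erase j ⊆ Finset.univ.filter fun k => k ≠ j ∧
          looThreshold q j W ≤ ((-(Function.update W j (-W j) k) : ℝ) : EReal) := by
        intro k hk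
        obtain ⟨hkj, hkA⟩ := Finset.mem_erase.1 hk
        have hk' : looThreshold q k W ≤ ((-W k : ℝ) : EReal) := (Finset.mem_filter.1 hkA).2
        rw [Finset.mem_filter, Function.update_of_ne hkj]
        refine ⟨Finset.mem_univ _, hkj, ?_⟩
        -- If the threshold for k is the smaller, it lies below both -W_k and -W_j, so the
        -- comparison lemma applies with j and k exchanged.
        rcases le_total (looThreshold q j W) (looThreshold q k W) with h | h
        · exact h.trans hk'
        · exact (looThreshold_le_of_le hk' (h.trans hj)).trans hk'
      have := Finset.card_le_card hsub
      rw [Finset.card_erase_of_mem hjA] at this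
      have h2 : A.card ≤ 1 + (Finset.univ.filter fun k => k ≠ j ∧
          looThreshold q j W ≤ ((-(Function.update W j (-W j) k) : ℝ) : EReal)).card := by omega
      exact_mod_cast h2
    · rw [if_neg hj]
      split_ifs <;> positivity
  calc ∑ j ∈ S₀, weight q j (Function.update W j (-W j))
      ≤ ∑ j ∈ S₀, if j ∈ A then (A.card : ℝ)⁻¹ else 0 := Finset.sum_le_sum fun j _ => hbound j
    _ ≤ ∑ j, if j ∈ A then (A.card : ℝ)⁻¹ else 0 :=
        Finset.sum_le_sum_of_subset_of_nonneg (Finset.subset_univ _)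
          fun j _ _ => by split_ifs <;> positivity
    _ = A.card * (A.card : ℝ)⁻¹ := by simp
    _ ≤ 1 := mul_inv_le_one

/-! ### Bounds between measures -/

lemma pi_le_smul_pi {ι : Type*} [Fintype ι] {μ ν : ι → Measure ℝ} [∀ i, SigmaFinite (μ i)]
    [∀ i, SigmaFinite (ν i)] {c : ι → ℝ≥0} (h : ∀ i, μ i ≤ c i • ν i) :
    Measure.pi μ ≤ (∏ i, c i) • Measure.pi ν := by
  have hpi : Measure.pi (fun i => c i • ν i) = (∏ i, c i) • Measure.pi ν := by
    refine Measure.pi_eq fun s _ => ?_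
    simp only [Measure.smul_apply, Measure.pi_pi, ENNReal.smul_def, smul_eq_mul,
      ENNReal.ofNNReal_finsetProd, Finset.prod_mul_distrib]
  rw [← hpi]
  intro s
  -- `OuterMeasure.pi` is the largest outer measure bounded on boxes by the product of the factors,
  -- so a comparison on boxes suffices.
  have hle : (Measure.pi μ).toOuterMeasure ≤
      OuterMeasure.pi fun i => (c i • ν i).toOuterMeasure := by
    refine OuterMeasure.le_pi.2 fun t _ => ?_
    change Measure.pi μ (Set.univ.pi t) ≤ _
    rw [Measure.pi_pi]
    exact Finset.prod_le_prod' fun i _ => h i (t i)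
  refine (hle s).trans ?_
  rw [Measure.pi]
  exact le_toMeasure_apply _ _ _

lemma map_comp_pi_eq {ι : Type*} [Fintype ι] (μ : ι → Measure ℝ) [∀ i, SigmaFinite (μ i)]
    {e : ι → ι} (he : Function.Involutive e) (hμ : ∀ i, μ (e i) = μ i) :
    (Measure.pi μ).map (fun v : ι → ℝ => v ∘ e) = Measure.pi μ := by
  refine (Measure.pi_eq fun s hs => ?_).symm
  have hmeas : Measurable fun v : ι → ℝ => v ∘ e :=
    measurable_pi_iff.2 fun i => measurable_pi_apply (e i)
  rw [Measure.map_apply hmeas (.univ_pi hs)]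
  have : (fun v : ι → ℝ => v ∘ e) ⁻¹' Set.univ.pi s = Set.univ.pi fun i => s (e i) := by
    ext v
    simp only [Set.mem_preimage, Set.mem_univ_pi, Function.comp_apply]
    exact ⟨fun h i => by simpa [he i] using h (e i), fun h i => by simpa [he i] using h (e i)⟩
  rw [this, Measure.pi_pi, ← Equiv.prod_comp he.toPerm]
  simp [Function.Involutive.coe_toPerm, he _, hμ]

instance sigmaFinite_laplace (b : ℝ) : SigmaFinite (laplace b) := by
  unfold laplace
  split_ifs
  · infer_instance
  · infer_instance

/-- The privacy property of the Laplace mechanism. -/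
lemma map_add_laplace_le {b v κ : ℝ} (hκ : 0 ≤ κ) (hv : |v| ≤ b * κ) :
    (laplace b).map (· + v) ≤ (Real.exp κ).toNNReal • laplace b := by
  rcases lt_or_ge 0 b with hb | hb
  · simp only [laplace, if_pos hb]
    have hf : Measurable fun x : ℝ => ENNReal.ofReal (Real.exp (-|x| / b) / (2 * b)) := by
      fun_prop
    refine Measure.le_iff.2 fun s hs => ?_
    rw [Measure.map_apply (measurable_add_const v) hs,
      withDensity_apply _ (measurable_add_const v hs), Measure.smul_apply, withDensity_apply _ hs,
      ENNReal.smul_def, smul_eq_mul, ← lintegral_const_mul _ hf]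
    calc ∫⁻ x in (· + v) ⁻¹' s, ENNReal.ofReal (Real.exp (-|x| / b) / (2 * b))
        ≤ ∫⁻ x in (· + v) ⁻¹' s, ((Real.exp κ).toNNReal : ENNReal) *
            ENNReal.ofReal (Real.exp (-|x + v| / b) / (2 * b)) := by
          refine lintegral_mono fun x => ?_
          change _ ≤ ENNReal.ofReal (Real.exp κ) * _
          rw [← ENNReal.ofReal_mul (Real.exp_nonneg κ), ← mul_div_assoc, ← Real.exp_add]
          refine ENNReal.ofReal_le_ofReal
            (div_le_div_of_nonneg_right (Real.exp_le_exp.2 ?_) (by positivity))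
          rw [← sub_le_iff_le_add, ← sub_div, div_le_iff₀ hb]
          have := abs_add_le x v
          linarith
      _ = ∫⁻ x in s, ((Real.exp κ).toNNReal : ENNReal) *
            ENNReal.ofReal (Real.exp (-|x| / b) / (2 * b)) :=
          (measurePreserving_add_right volume v).setLIntegral_comp_preimage hs
            (hf.const_mul _)
  -- For a degenerate scale the hypothesis forces a zero shift.
  · have hv0 : v = 0 := abs_eq_zero.1
      (le_antisymm (hv.trans (mul_nonpos_of_nonpos_of_nonneg hb hκ)) (abs_nonneg v))
    have h1 : (1 : ℝ≥0) ≤ (Real.exp κ).toNNReal := by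
      rw [← Real.toNNReal_one]
      exact Real.toNNReal_le_toNNReal (Real.one_le_exp hκ)
    subst hv0
    intro s
    simp only [add_zero, Measure.map_id', Measure.smul_apply, ENNReal.smul_def, smul_eq_mul]
    exact le_mul_of_one_le_left' (by exact_mod_cast h1)

/-- The image of a centred isotropic Gaussian vector under `A` only depends on `A Aᵀ`. -/
lemma map_mulVec_gaussian_eq {m n : Type*} [Fintype m] [Fintype n] (v : ℝ≥0)
    {A B : Matrix m n ℝ} (h : A * Aᵀ = B * Bᵀ) :
    (Measure.pi fun _ : n => gaussianReal 0 v).map (A *ᵥ ·) =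
      (Measure.pi fun _ : n => gaussianReal 0 v).map (B *ᵥ ·) := by
  classical
  -- Characteristic functions also cover singular covariances, where no density exists.
  have key : ∀ (C : Matrix m n ℝ) (L : StrongDual ℝ (m → ℝ)),
      charFunDual ((Measure.pi fun _ : n => gaussianReal 0 v).map (C *ᵥ ·)) L =
        Complex.exp (-(v / 2 * ((fun i => L (Pi.single i 1)) ⬝ᵥ
          ((C * Cᵀ) *ᵥ fun i => L (Pi.single i 1)) : ℝ) : ℂ)) := by
    intro C L
    set ℓ : m → ℝ := fun i => L (Pi.single i 1)
    have hL : ∀ x, L x = ℓ ⬝ᵥ x := by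
      intro x
      conv_lhs => rw [pi_eq_sum_univ' x]
      simp [dotProduct, ℓ, mul_comm]
    have hC : (C *ᵥ · : (n → ℝ) → m → ℝ) =
        ((Matrix.mulVecLin C).toContinuousLinearMap : (n → ℝ) →L[ℝ] (m → ℝ)) := rfl
    rw [hC, charFunDual_map, charFunDual_pi]
    have hterm : ∀ i, charFunDual (gaussianReal 0 v)
        ((L.comp (Matrix.mulVecLin C).toContinuousLinearMap).comp
          (ContinuousLinearMap.single ℝ (fun _ : n => ℝ) i)) =
        Complex.exp (-(v / 2 * ((ℓ ᵥ* C) i ^ 2 : ℝ) : ℂ)) := by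
      intro i
      have happ : ∀ x : ℝ, (L.comp (Matrix.mulVecLin C).toContinuousLinearMap).comp
          (ContinuousLinearMap.single ℝ (fun _ : n => ℝ) i) x = (ℓ ᵥ* C) i * x := by
        intro x
        change L (C *ᵥ Pi.single i x) = _
        rw [hL, Matrix.dotProduct_mulVec, dotProduct_single]
      rw [charFunDual_apply]
      simp_rw [happ, Complex.ofReal_mul]
      rw [← charFun_apply_real, charFun_gaussianReal]
      congr 1
      push_cast
      ring
    rw [Finset.prod_congr rfl fun i _ => hterm i, ← Complex.exp_sum]
    congr 1
    rw [Finset.sum_neg_distrib, ← Finset.mul_sum, ← Matrix.mulVec_mulVec, Matrix.dotProduct_mulVec,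
      Matrix.mulVec_transpose]
    simp [dotProduct, pow_two]
  have : ∀ C : Matrix m n ℝ, IsProbabilityMeasure
      ((Measure.pi fun _ : n => gaussianReal 0 v).map (C *ᵥ ·)) := fun C =>
    Measure.isProbabilityMeasure_map (by fun_prop)
  refine Measure.ext_of_charFunDual (funext fun L => ?_)
  rw [key, key, h]

/-- With the first factor fixed, the noise bound replaces m by S m at cost c. Invariance of the law
of a replaces a by S ∘ a, invariance of μ does the same for the noise, and additivity pulls S out,
both at no cost. -/
lemma map_add_prod_le_smul {E F : Type*} [MeasurableSpace E] [AddCommGroup F] [MeasurableSpace F]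
    [MeasurableAdd₂ F] (γ : Measure E) [SFinite γ] (μ : Measure F) [SFinite μ] {a : E → F}
    (ha : Measurable a) {S : F →+ F} (hS : Measurable S) (m : F) (c : ℝ≥0)
    (hγ : γ.map (S ∘ a) = γ.map a) (hμ : μ.map S = μ)
    (hc : μ.map (· + m) ≤ c • μ.map (· + S m)) :
    (γ.prod μ).map (fun x => m + a x.1 + x.2) ≤
      c • ((γ.prod μ).map (fun x => m + a x.1 + x.2)).map S := by
  have hmeas : Measurable fun x : E × F => m + a x.1 + x.2 := by fun_prop
  refine Measure.le_iff.2 fun s hs => ?_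
  rw [Measure.smul_apply, Measure.map_apply hS hs, Measure.map_apply hmeas hs,
    Measure.map_apply hmeas (hS hs), Measure.prod_apply (hmeas hs),
    Measure.prod_apply (hmeas (hS hs)), ENNReal.smul_def, smul_eq_mul]
  have hg : Measurable fun u : F => μ {y | y + S m + u ∈ s} := by
    have : Measurable fun x : F × F => x.2 + S m + x.1 := by fun_prop
    exact measurable_measure_prodMk_left (this hs)
  have hsets : ∀ u : F, MeasurableSet {y : F | y + u ∈ s} := fun u => measurable_add_const u hs
  calc ∫⁻ x, μ (Prod.mk x ⁻¹' ((fun x => m + a x.1 + x.2) ⁻¹' s)) ∂γ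
      ≤ ∫⁻ x, c * μ {y | y + S m + a x ∈ s} ∂γ := by
        refine lintegral_mono fun x => ?_
        have := hc {y | y + a x ∈ s}
        rw [Measure.smul_apply, Measure.map_apply (measurable_add_const _) (hsets _),
          Measure.map_apply (measurable_add_const _) (hsets _), ENNReal.smul_def,
          smul_eq_mul] at this
        refine (measure_mono fun y hy => ?_).trans this
        rw [Set.mem_preimage, Set.mem_preimage,
          show m + a x + y = y + m + a x by abel] at hy
        exact hy
    _ = c * ∫⁻ u, μ {y | y + S m + u ∈ s} ∂(γ.map a) := by
        rw [lintegral_map hg ha]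
        exact lintegral_const_mul _ (hg.comp ha)
    _ = c * ∫⁻ x, μ {y | y + S m + S (a x) ∈ s} ∂γ := by
        rw [← hγ, lintegral_map hg (hS.comp ha)]
        rfl
    _ = c * ∫⁻ x, μ (Prod.mk x ⁻¹' ((fun x => m + a x.1 + x.2) ⁻¹' (S ⁻¹' s))) ∂γ := by
        congr 1
        refine lintegral_congr fun x => ?_
        have hs' : MeasurableSet {y | y + S m + S (a x) ∈ s} := by
          simp_rw [add_assoc]
          exact hsets _
        conv_lhs => rw [← hμ, Measure.map_apply hS hs']
        congr 1
        ext y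
        simp only [Set.mem_preimage, Set.mem_ofPred_eq, map_add]
        rw [show S m + S (a x) + S y = S y + S m + S (a x) by abel]

/-! ### Swaps -/

/-- The permutation of the indices underlying `swap F`. -/
def swapIndex {p : ℕ} (F : Finset (Fin p)) : Fin p ⊕ Fin p → Fin p ⊕ Fin p :=
  Sum.elim (fun i => if i ∈ F then Sum.inr i else Sum.inl i)
    (fun i => if i ∈ F then Sum.inl i else Sum.inr i)

lemma swap_eq_comp {p : ℕ} (F : Finset (Fin p)) (v : Fin p ⊕ Fin p → ℝ) :
    swap F v = v ∘ swapIndex F := by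
  ext (i | i) <;> by_cases hi : i ∈ F <;> simp [swap, swapIndex, hi]

lemma swapIndex_involutive {p : ℕ} (F : Finset (Fin p)) :
    Function.Involutive (swapIndex F) := by
  rintro (i | i) <;> by_cases hi : i ∈ F <;> simp [swapIndex, hi]

/-- `swap F` as an additive homomorphism. -/
def swapHom {p : ℕ} (F : Finset (Fin p)) : (Fin p ⊕ Fin p → ℝ) →+ (Fin p ⊕ Fin p → ℝ) where
  toFun := swap F
  map_zero' := by rw [swap_eq_comp]; rfl
  map_add' u v := by simp only [swap_eq_comp]; rfl

lemma measurable_swap {p : ℕ} (F : Finset (Fin p)) :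
    Measurable (swap F : (Fin p ⊕ Fin p → ℝ) → _) := by
  rw [funext (swap_eq_comp F)]
  exact measurable_pi_iff.2 fun i => measurable_pi_apply _

/-! ### Swap symmetry of the Gram matrix and of the Gaussian part -/

lemma IsKnockoff.gram_eq_fromBlocks {n p : ℕ} {X Xk : Matrix (Fin n) (Fin p) ℝ}
    (h : IsKnockoff X Xk) :
    gram X Xk = Matrix.fromBlocks (Xᵀ * X) (Xᵀ * X - Matrix.diagonal (gap X Xk))
      (Xᵀ * X - Matrix.diagonal (gap X Xk)) (Xᵀ * X) := by
  have h' : Xkᵀ * X = Xᵀ * X - Matrix.diagonal (gap X Xk) := by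
    have := congrArg Matrix.transpose h.cross_eq
    simpa [Matrix.transpose_mul] using this
  rw [gram, Matrix.transpose_fromCols, Matrix.fromRows_mul_fromCols, h.gram_eq, h.cross_eq, h']

/-- Blocks get mixed only at entries (i, k) with exactly one index in F; then i ≠ k, where Σ and Σ -
diag s agree. -/
lemma IsKnockoff.gram_swapIndex {n p : ℕ} {X Xk : Matrix (Fin n) (Fin p) ℝ}
    (h : IsKnockoff X Xk) (F : Finset (Fin p)) :
    (gram X Xk).submatrix (swapIndex F) (swapIndex F) = gram X Xk := by
  rw [h.gram_eq_fromBlocks]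
  have hoff : ∀ {i k : Fin p}, i ∈ F → k ∉ F → Matrix.diagonal (gap X Xk) i k = 0 := by
    intro i k hi hk
    exact Matrix.diagonal_apply_ne _ fun h => hk (h ▸ hi)
  have hoff' : ∀ {i k : Fin p}, i ∉ F → k ∈ F → Matrix.diagonal (gap X Xk) i k = 0 := by
    intro i k hi hk
    exact Matrix.diagonal_apply_ne _ fun h => hi (h ▸ hk)
  ext (i | i) (k | k) <;> by_cases hi : i ∈ F <;> by_cases hk : k ∈ F <;>
    first
    | (simp [swapIndex, hi, hk]; done)
    | simp [swapIndex, hi, hk, hoff hi hk]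
    | simp [swapIndex, hi, hk, hoff' hi hk]

/-- The squared distance between X_i and X̃_i is 2 s_i. -/
lemma IsKnockoff.gap_nonneg {n p : ℕ} {X Xk : Matrix (Fin n) (Fin p) ℝ}
    (h : IsKnockoff X Xk) (hX : ∀ i, X.col i ⬝ᵥ X.col i = 1) (i : Fin p) : 0 ≤ gap X Xk i := by
  have hXk : Xk.col i ⬝ᵥ Xk.col i = 1 := by
    rw [← hX i]
    exact congrFun (congrFun h.gram_eq i) i
  have h0 : 0 ≤ (X.col i - Xk.col i) ⬝ᵥ (X.col i - Xk.col i) :=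
    Finset.sum_nonneg fun _ _ => mul_self_nonneg _
  rw [sub_dotProduct, dotProduct_sub, dotProduct_sub, hX, hXk,
    dotProduct_comm (Xk.col i)] at h0
  unfold gap
  linarith

lemma IsKnockoff.mulVec_inl_sub_inr {n p : ℕ} {X Xk : Matrix (Fin n) (Fin p) ℝ}
    (h : IsKnockoff X Xk) (β : Fin p → ℝ) (i : Fin p) :
    ((Matrix.fromCols X Xk)ᵀ *ᵥ (X *ᵥ β)) (Sum.inl i) -
      ((Matrix.fromCols X Xk)ᵀ *ᵥ (X *ᵥ β)) (Sum.inr i) = gap X Xk i * β i := by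
  have h' : Xkᵀ * X = Xᵀ * X - Matrix.diagonal (gap X Xk) := by
    have := congrArg Matrix.transpose h.cross_eq
    simpa [Matrix.transpose_mul] using this
  rw [Matrix.transpose_fromCols, Matrix.fromRows_mulVec, Sum.elim_inl, Sum.elim_inr,
    Matrix.mulVec_mulVec, Matrix.mulVec_mulVec, h', Matrix.sub_mulVec, Pi.sub_apply,
    Matrix.mulVec_diagonal]
  ring

lemma IsKnockoff.map_swap_mulVec_gaussian {n p : ℕ} {X Xk : Matrix (Fin n) (Fin p) ℝ}
    (h : IsKnockoff X Xk) (F : Finset (Fin p)) (v : ℝ≥0) :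
    (Measure.pi fun _ : Fin n => gaussianReal 0 v).map
        (swap F ∘ ((Matrix.fromCols X Xk)ᵀ *ᵥ ·)) =
      (Measure.pi fun _ : Fin n => gaussianReal 0 v).map ((Matrix.fromCols X Xk)ᵀ *ᵥ ·) := by
  set A := (Matrix.fromCols X Xk)ᵀ with hA
  have hcomp : (swap F ∘ (A *ᵥ ·) : (Fin n → ℝ) → _) = (A.submatrix (swapIndex F) id *ᵥ ·) := by
    funext x
    simp only [Function.comp_apply, swap_eq_comp]
    rfl
  rw [hcomp]
  refine map_mulVec_gaussian_eq v ?_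
  have hG : A * Aᵀ = gram X Xk := by rw [gram, hA, Matrix.transpose_transpose]
  rw [Matrix.transpose_submatrix, ← Matrix.submatrix_mul A Aᵀ _ id _ Function.bijective_id, hG,
    h.gram_swapIndex F]

/-- The law of the noise added to the products of the response with the augmented design. -/
noncomputable abbrev noise {n p : ℕ} (X Xk : Matrix (Fin n) (Fin p) ℝ) (δ ε : ℝ) :
    Measure (Fin p ⊕ Fin p → ℝ) :=
  Measure.pi (Sum.elim
        (fun i => laplace (2 * gap X Xk i * δ / ε)) (fun i => laplace (2 * gap X Xk i * δ / ε)))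

instance sigmaFinite_sumElim {α ι κ : Type*} [MeasurableSpace α] (μ : ι → Measure α)
    (ν : κ → Measure α) [∀ i, SigmaFinite (μ i)] [∀ i, SigmaFinite (ν i)] (i : ι ⊕ κ) :
    SigmaFinite (Sum.elim μ ν i) := by
  cases i
  · rw [Sum.elim_inl]; infer_instance
  · rw [Sum.elim_inr]; infer_instance

lemma map_swap_noise {n p : ℕ} (X Xk : Matrix (Fin n) (Fin p) ℝ) (δ ε : ℝ)
    (F : Finset (Fin p)) : (noise X Xk δ ε).map (swap F) = noise X Xk δ ε := by
  rw [funext (swap_eq_comp F)]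
  refine map_comp_pi_eq _ (swapIndex_involutive F) ?_
  rintro (i | i) <;> by_cases hi : i ∈ F <;> simp [swapIndex, hi]

/-! ### Cost of swapping the mean under Laplace noise -/

instance sigmaFinite_map_add (μ : Measure ℝ) [SigmaFinite μ] (v : ℝ) :
    SigmaFinite (μ.map (· + v)) :=
  (MeasurableEquiv.addRight v).sigmaFinite_map

lemma map_add_pi_eq {ι : Type*} [Fintype ι] (μ : ι → Measure ℝ) [∀ i, SigmaFinite (μ i)]
    (m : ι → ℝ) : (Measure.pi μ).map (· + m) = Measure.pi fun i => (μ i).map (· + m i) :=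
  Measure.pi_map_pi (f := fun i x => x + m i) fun i => (measurable_add_const (m i)).aemeasurable

lemma map_add_noise_le {n p : ℕ} {X Xk : Matrix (Fin n) (Fin p) ℝ} {δ ε : ℝ} (hε : 0 < ε)
    {j : Fin p} {m : Fin p ⊕ Fin p → ℝ}
    (hm : |m (Sum.inl j) - m (Sum.inr j)| ≤ gap X Xk j * δ) :
    (noise X Xk δ ε).map (· + m) ≤
      (Real.exp ε).toNNReal • (noise X Xk δ ε).map (· + swap {j} m) := by
  set κ : ℝ≥0 := (Real.exp (ε / 2)).toNNReal with hκ
  -- The 2 in the scale splits the budget ε equally between the two swapped coordinates.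
  have hscale : 2 * gap X Xk j * δ / ε * (ε / 2) = gap X Xk j * δ := by field_simp
  have hshift : ∀ {b u v : ℝ}, |u - v| ≤ b * (ε / 2) →
      (laplace b).map (· + u) ≤ κ • (laplace b).map (· + v) := by
    intro b u v huv
    have := Measure.map_mono (map_add_laplace_le (half_pos hε).le huv) (measurable_add_const v)
    rw [Measure.map_map (measurable_add_const v) (measurable_add_const _),
      Measure.map_smul] at this
    have hcomp : ((· + v) ∘ (· + (u - v)) : ℝ → ℝ) = (· + u) := by
      funext x
      change x + (u - v) + v = x + u
      ring
    rwa [hcomp] at this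
  have hprod : ∏ i : Fin p ⊕ Fin p, (if i = Sum.inl j ∨ i = Sum.inr j then κ else 1) =
      (Real.exp ε).toNNReal := by
    rw [Fintype.prod_sum_type]
    simp only [Sum.inl.injEq, reduceCtorEq, or_false, Sum.inr.injEq, false_or,
      Finset.prod_ite_eq', Finset.mem_univ, if_true]
    rw [hκ, ← Real.toNNReal_mul (Real.exp_nonneg _), ← Real.exp_add, add_halves]
  rw [map_add_pi_eq, map_add_pi_eq, ← hprod]
  refine pi_le_smul_pi ?_
  rintro (i | i) <;> by_cases hi : i = j
  · subst hi
    simpa [swap] using hshift (hm.trans_eq hscale.symm)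
  · simp [swap, hi]
  · subst hi
    rw [abs_sub_comm] at hm
    simpa [swap] using hshift (hm.trans_eq hscale.symm)
  · simp [swap, hi]

/-- The law of the perturbed products changes by a factor at most `exp ε` when the entries of a
null variable and of its knockoff are swapped. -/
lemma IsKnockoff.map_perturbed_le {n p : ℕ} {X Xk : Matrix (Fin n) (Fin p) ℝ}
    (h : IsKnockoff X Xk) (hX : ∀ i, X.col i ⬝ᵥ X.col i = 1) {β : Fin p → ℝ} {δ ε : ℝ}
    (hε : 0 < ε) (v : ℝ≥0) {j : Fin p} (hj : j ∈ nulls β δ) (μ : Measure (Fin p ⊕ Fin p → ℝ))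
    (hμ : μ = ((Measure.pi fun _ : Fin n => gaussianReal 0 v).prod (noise X Xk δ ε)).map
      fun x => (Matrix.fromCols X Xk)ᵀ *ᵥ (X *ᵥ β) + (Matrix.fromCols X Xk)ᵀ *ᵥ x.1 + x.2) :
    μ ≤ (Real.exp ε).toNNReal • μ.map (swap {j}) := by
  subst hμ
  refine map_add_prod_le_smul (S := swapHom {j}) _ _ (by fun_prop) (measurable_swap {j}) _ _
    (h.map_swap_mulVec_gaussian {j} v) (map_swap_noise X Xk δ ε {j}) (map_add_noise_le hε ?_)
  have hj' : |β j| ≤ δ := by simpa [nulls] using hj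
  have hs := h.gap_nonneg hX j
  rw [h.mulVec_inl_sub_inr, abs_mul, abs_of_nonneg hs]
  exact mul_le_mul_of_nonneg_left hj' hs

/-- Control of the false discovery rate under approximate sign symmetry of the nulls. -/
lemma integral_fdp_selected_le {p : ℕ} {q c : ℝ} (hq : 0 ≤ q) (hc : 0 ≤ c) {α : Type*}
    [MeasurableSpace α] (μ : Measure α) [IsProbabilityMeasure μ] {W : α → Fin p → ℝ}
    (hW : Measurable W) (S₀ : Finset (Fin p)) (S : Fin p → α → α) (hS : ∀ j, Measurable (S j))
    (hWS : ∀ j z, W (S j z) = Function.update (W z) j (-W z j))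
    (hμ : ∀ j ∈ S₀, μ ≤ c.toNNReal • μ.map (S j)) :
    ∫ z, fdp (selected q (W z)) S₀ ∂μ ≤ q * c := by
  have hmeas : ∀ j, Measurable fun z => weight q j (W z) :=
    fun j => (measurable_weight q j).comp hW
  have hint : ∀ (ν : Measure α) [IsFiniteMeasure ν] (j : Fin p),
      Integrable (fun z => weight q j (W z)) ν := fun ν _ j =>
    Integrable.of_bound (hmeas j).aestronglyMeasurable 1 (ae_of_all _ fun z => by
      rw [Real.norm_of_nonneg (weight_nonneg q j _)]
      exact weight_le_one q j _)
  have hint' : ∀ j : Fin p, Integrable (fun z => weight q j (W (S j z))) μ := fun j =>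
    Integrable.of_bound ((hmeas j).comp (hS j)).aestronglyMeasurable 1 (ae_of_all _ fun z => by
      rw [Real.norm_of_nonneg (weight_nonneg q j _)]
      exact weight_le_one q j _)
  -- The change of measure is applied to each weight separately, so no joint symmetry of the null
  -- signs is needed.
  have hstep : ∀ j ∈ S₀, ∫ z, weight q j (W z) ∂μ ≤ c * ∫ z, weight q j (W (S j z)) ∂μ := by
    intro j hj
    have : IsProbabilityMeasure (μ.map (S j)) :=
      Measure.isProbabilityMeasure_map (hS j).aemeasurable
    calc ∫ z, weight q j (W z) ∂μ ≤ ∫ z, weight q j (W z) ∂(c.toNNReal • μ.map (S j)) :=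
          integral_mono_measure (hμ j hj) (ae_of_all _ fun z => weight_nonneg q j _) (hint _ j)
      _ = c * ∫ z, weight q j (W (S j z)) ∂μ := by
          rw [integral_smul_nnreal_measure,
            integral_map (hS j).aemeasurable (hmeas j).aestronglyMeasurable, NNReal.smul_def,
            Real.coe_toNNReal c hc, smul_eq_mul]
  calc ∫ z, fdp (selected q (W z)) S₀ ∂μ
      ≤ ∫ z, q * ∑ j ∈ S₀, weight q j (W z) ∂μ :=
        integral_mono_of_nonneg (ae_of_all _ fun z => fdp_nonneg _ _)
          ((integrable_finsetSum _ fun j _ => hint μ j).const_mul q)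
          (ae_of_all _ fun z => fdp_selected_le_sum_weight hq (W z) S₀)
    _ = q * ∑ j ∈ S₀, ∫ z, weight q j (W z) ∂μ := by
        rw [integral_const_mul, integral_finsetSum _ fun j _ => hint μ j]
    _ ≤ q * ∑ j ∈ S₀, c * ∫ z, weight q j (W (S j z)) ∂μ :=
        mul_le_mul_of_nonneg_left (Finset.sum_le_sum hstep) hq
    _ = q * (c * ∫ z, ∑ j ∈ S₀, weight q j (W (S j z)) ∂μ) := by
        rw [← Finset.mul_sum, integral_finsetSum _ fun j _ => hint' j]
    _ ≤ q * (c * 1) := by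
        refine mul_le_mul_of_nonneg_left (mul_le_mul_of_nonneg_left ?_ hc) hq
        calc ∫ z, ∑ j ∈ S₀, weight q j (W (S j z)) ∂μ ≤ ∫ _, (1 : ℝ) ∂μ :=
              integral_mono (integrable_finsetSum _ fun j _ => hint' j) (integrable_const 1)
                fun z => by
                  simp only [hWS]
                  exact sum_weight_update_neg_le_one q (W z) S₀
          _ = 1 := by simp
    _ = q * c := by rw [mul_one]

end Knockoff
-- Integrability is part of the conclusion because the integral of a non-integrable function is 0 by
-- convention, which would make the bound void.
theorem mainTheorem3 {Ω : Type*} [MeasurableSpace Ω] (P : Measure Ω) [IsProbabilityMeasure P]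
    {n p : ℕ} (X Xk : Matrix (Fin n) (Fin p) ℝ)
    (hX_norm : ∀ i, (X.col i) ⬝ᵥ (X.col i) = 1)
    (hX_inv : IsUnit (Xᵀ * X))
    (hXk : Knockoff.IsKnockoff X Xk)
    (β : Fin p → ℝ) (σ : ℝ≥0) (δ ε q : ℝ) (hδ : 0 ≤ δ) (hε : 0 < ε) (hq : q ∈ Set.Icc (0 : ℝ) 1)
    (y w : Ω → Fin n → ℝ) (Δ : Ω → Fin p ⊕ Fin p → ℝ)
    (hy : ∀ ω, y ω = X *ᵥ β + w ω)
    (hw : HasLaw w (Measure.pi fun _ : Fin n => gaussianReal 0 (σ ^ 2)) P)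
    (hΔ : HasLaw Δ
      (Measure.pi (Sum.elim
        (fun i => Knockoff.laplace (2 * Knockoff.gap X Xk i * δ / ε))
        (fun i => Knockoff.laplace (2 * Knockoff.gap X Xk i * δ / ε)))) P)
    (hwΔ : IndepFun w Δ P)
    (T : Matrix (Fin p ⊕ Fin p) (Fin p ⊕ Fin p) ℝ →
      (Fin p ⊕ Fin p → ℝ) → (Fin p ⊕ Fin p → ℝ))
    (hT_meas : Measurable (T (Knockoff.gram X Xk)))
    (hT : Knockoff.SwapEquivariant (T (Knockoff.gram X Xk)))
    (𝒲 : (Fin p ⊕ Fin p → ℝ) → (Fin p → ℝ))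
    (h𝒲_meas : Measurable 𝒲) (h𝒲 : Knockoff.Antisymmetric 𝒲) :
    Integrable (fun ω => Knockoff.fdp
      (Knockoff.selected (q / Real.exp ε) (Knockoff.frppStatistics X Xk T 𝒲 (y ω) (Δ ω)))
      (Knockoff.nulls β δ)) P ∧
    ∫ ω, Knockoff.fdp
      (Knockoff.selected (q / Real.exp ε) (Knockoff.frppStatistics X Xk T 𝒲 (y ω) (Δ ω)))
      (Knockoff.nulls β δ) ∂P ≤ q := by
  have hnoise : HasLaw Δ (Knockoff.noise X Xk δ ε) P := hΔ
  set A := (Matrix.fromCols X Xk)ᵀ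
  set Z : Ω → Fin p ⊕ Fin p → ℝ := fun ω => A *ᵥ (X *ᵥ β) + A *ᵥ w ω + Δ ω
  set W : (Fin p ⊕ Fin p → ℝ) → Fin p → ℝ := fun z => 𝒲 (T (Knockoff.gram X Xk) z)
  have hstat : ∀ ω, Knockoff.frppStatistics X Xk T 𝒲 (y ω) (Δ ω) = W (Z ω) := by
    intro ω
    rw [Knockoff.frppStatistics, hy, Matrix.mulVec_add]
  have hWmeas : Measurable W := h𝒲_meas.comp hT_meas
  have hmap : Measurable fun x : (Fin n → ℝ) × (Fin p ⊕ Fin p → ℝ) =>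
      A *ᵥ (X *ᵥ β) + A *ᵥ x.1 + x.2 := by fun_prop
  have hjoint : AEMeasurable (fun ω => (w ω, Δ ω)) P := hw.aemeasurable.prodMk hΔ.aemeasurable
  have hcomp := hmap.comp_aemeasurable hjoint
  have hZmeas : AEMeasurable Z P := hcomp
  -- Independence of w and Δ makes their joint law the product measure.
  have hlaw : P.map Z = ((Measure.pi fun _ : Fin n => gaussianReal 0 (σ ^ 2)).prod
      (Knockoff.noise X Xk δ ε)).map fun x => A *ᵥ (X *ᵥ β) + A *ᵥ x.1 + x.2 := by
    rw [← hw.map_eq, ← hnoise.map_eq, ← (indepFun_iff_map_prod_eq_prod_map_map hw.aemeasurable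
      hΔ.aemeasurable).1 hwΔ, AEMeasurable.map_map_of_aemeasurable hmap.aemeasurable hjoint]
    rfl
  have hWS : ∀ j z, W (Knockoff.swap {j} z) = Function.update (W z) j (-W z j) := by
    intro j z
    funext k
    simp only [W]
    rw [hT j z, h𝒲 {j}]
    by_cases hk : k = j
    · subst hk; simp
    · simp [hk]
  have hfdp : Measurable fun z => Knockoff.fdp (Knockoff.selected (q / Real.exp ε) (W z))
      (Knockoff.nulls β δ) := (Knockoff.measurable_fdp_selected _ _).comp hWmeas
  simp only [hstat]
  constructor
  · have hbound : ∀ z, ‖Knockoff.fdp (Knockoff.selected (q / Real.exp ε) (W z))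
        (Knockoff.nulls β δ)‖ ≤ 1 := fun z => by
      rw [Real.norm_of_nonneg (Knockoff.fdp_nonneg _ _)]
      exact Knockoff.fdp_le_one _ _
    have hmeas : AEStronglyMeasurable (fun ω => Knockoff.fdp
        (Knockoff.selected (q / Real.exp ε) (W (Z ω))) (Knockoff.nulls β δ)) P :=
      (hfdp.comp_aemeasurable hZmeas).aestronglyMeasurable
    exact Integrable.of_bound hmeas 1 (ae_of_all P fun ω => hbound (Z ω))
  · have : IsProbabilityMeasure (P.map Z) := Measure.isProbabilityMeasure_map hZmeas
    have hswap : ∀ j ∈ Knockoff.nulls β δ,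
        P.map Z ≤ (Real.exp ε).toNNReal • (P.map Z).map (Knockoff.swap {j}) :=
      fun j hj => hXk.map_perturbed_le hX_norm hε (σ ^ 2) hj _ hlaw
    have hmain := Knockoff.integral_fdp_selected_le (q := q / Real.exp ε)
      (div_nonneg hq.1 (Real.exp_nonneg ε)) (Real.exp_nonneg ε) (P.map Z) hWmeas
      (Knockoff.nulls β δ) (fun j => Knockoff.swap {j}) (fun j => Knockoff.measurable_swap {j})
      hWS hswap
    rw [div_mul_cancel₀ q (Real.exp_pos ε).ne',
      integral_map hZmeas hfdp.aestronglyMeasurable] at hmain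
    exact hmain
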